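/- Let $k,n$ be non-negative integers, let $M=(m_{ij})$ be a real symmetric positive definite $k\times k$ matrix with $m_{ii}=1$ for all $i$, and let $X=(X_1,\dots,X_k)$, with $X_i\in\mathbb{R}^n$, be a $kn$-dimensional Gaussian random vector with mean zero and covariance $M\otimes I_n$. Let $\Psi:[0,1]^k\to\mathbb{R}$ be continuous, and twice continuously differentiable on $(0,1)^k$ with Hessian matrix $H_\Psi=(\partial_i\partial_j\Psi)_{i,j}$. Suppose that for every $x\in(0,1)^k$ the Hadamard (entrywise) product $M\odot H_\Psi(x)$ is negative semidefinite. Then for every measurable $F=(f_1,\dots,f_k):\mathbb{R}^n\to[0,1]^k$ the random variable $\Psi(f_1(X_1),\dots,f_k(X_k))$ is integrable and \[ \mathbb{E}\,\Psi\big(f_1(X_1),\dots,f_k(X_k)\big)\le \Psi\big(\mathbb{E} f_1(X_1),\dots,\mathbb{E} f_k(X_k)\big). \] -/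

import Mathlib

namespace GaussianDiffusion

/-- The Hessian matrix of `Ψ` at `x`: its `(i, j)` entry is the second partial derivative of `Ψ`
at `x` along the `i`-th and the `j`-th coordinate directions. -/
noncomputable def hessianMatrix {k : ℕ} (Ψ : (Fin k → ℝ) → ℝ) (x : Fin k → ℝ) :
    Matrix (Fin k) (Fin k) ℝ :=
  Matrix.of fun i j => fderiv ℝ (fderiv ℝ Ψ) x (Pi.single i 1) (Pi.single j 1)

/-- The closed unit cube `[0, 1]^k`. -/
def closedCube (k : ℕ) : Set (Fin k → ℝ) := {x | ∀ i, x i ∈ Set.Icc (0 : ℝ) 1}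

/-- The open unit cube `(0, 1)^k`. -/
def openCube (k : ℕ) : Set (Fin k → ℝ) := {x | ∀ i, x i ∈ Set.Ioo (0 : ℝ) 1}

/-- The `i`-th block `x_i ∈ ℝⁿ` of a vector `x = (x_1, …, x_k) ∈ ℝ^{kn}`. -/
noncomputable def block {k n : ℕ} (x : EuclideanSpace ℝ (Fin k × Fin n)) (i : Fin k) :
    EuclideanSpace ℝ (Fin n) :=
  WithLp.toLp 2 fun a => x (i, a)

/-- For `F = (f_1, …, f_k) : ℝⁿ → ℝ^k` and `x = (x_1, …, x_k) ∈ ℝ^{kn}`, the vector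
`F(x) = (f_1(x_1), …, f_k(x_k))`. -/
noncomputable def blockEval {k n : ℕ} (F : EuclideanSpace ℝ (Fin n) → Fin k → ℝ)
    (x : EuclideanSpace ℝ (Fin k × Fin n)) : Fin k → ℝ :=
  fun i => F (block x i) i

end GaussianDiffusion

open MeasureTheory ProbabilityTheory GaussianDiffusion
open scoped Matrix Kronecker

namespace GaussianDiffusion

/-! A centred Gaussian vector is a sum of `N` independent copies of itself scaled by `√(1/N)`, so
the expectation can be taken one small step at a time. For a step `s • z`, expand `Ψ` to second
order about the mean `b` of `G (x + s • z)`. The linear term averages to zero. To first order the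
`i`-th component of `G` sees only the `i`-th block of `z`, so the quadratic term averages to a sum,
over the coordinates of `ℝⁿ`, of values of the form `M ⊙ H_Ψ(b)`, and is nonpositive
(`integral_bilin_nonpos`). The rest is `o(s²)`, uniformly over the class `BlockSmooth K η`
(`BlockSmooth.exists_one_step`). Averaging `G` over a step stays in this class with the same
constants, so `N` steps cost only `N * o(1/N)` (`BlockSmooth.integral_convPow_le`).

Values in `[η, 1 - η]` keep every expansion in a compact part of the open cube, where the Hessian is
uniformly continuous. A general `F` is reached by `L¹` approximation (`exists_smooth_approx`) and
the modulus of continuity of `Ψ` on the closed cube. -/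

/-! ### Taylor expansion with uniform remainder -/

/-- One-dimensional second order Taylor bound. -/
lemma le_taylor_two_of_deriv_le {φ φ' φ'' : ℝ → ℝ} {B : ℝ}
    (h1 : ∀ s ∈ Set.Icc (0 : ℝ) 1, HasDerivAt φ (φ' s) s)
    (h2 : ∀ s ∈ Set.Icc (0 : ℝ) 1, HasDerivAt φ' (φ'' s) s)
    (hB : ∀ s ∈ Set.Icc (0 : ℝ) 1, φ'' s ≤ B) :
    φ 1 ≤ φ 0 + φ' 0 + B / 2 := by
  have key : ∀ {u u' : ℝ → ℝ}, (∀ s ∈ Set.Icc (0 : ℝ) 1, HasDerivAt u (u' s) s) →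
      (∀ s ∈ Set.Icc (0 : ℝ) 1, u' s ≤ 0) → AntitoneOn u (Set.Icc 0 1) := by
    intro u u' hu hu'
    refine antitoneOn_of_deriv_nonpos (convex_Icc 0 1)
      (fun s hs => (hu s hs).continuousAt.continuousWithinAt)
      (fun s hs => (hu s (interior_subset hs)).differentiableAt.differentiableWithinAt)
      (fun s hs => ?_)
    rw [(hu s (interior_subset hs)).deriv]
    exact hu' s (interior_subset hs)
  -- Integrate the bound twice: `φ' s - B * s` decreases, which makes the derivative of the next
  -- function nonpositive.
  have a1 := key (u := fun s => φ' s - B * s) (u' := fun s => φ'' s - B * 1)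
    (fun s hs => (h2 s hs).sub ((hasDerivAt_id s).const_mul B))
    (fun s hs => by linarith [hB s hs])
  have a2 := key (u := fun s => φ s - φ' 0 * s - B / 2 * s ^ 2)
    (u' := fun s => φ' s - φ' 0 * 1 - B / 2 * (((2 : ℕ) : ℝ) * s ^ (2 - 1)))
    (fun s hs => ((h1 s hs).sub ((hasDerivAt_id s).const_mul (φ' 0))).sub
      ((hasDerivAt_pow 2 s).const_mul (B / 2)))
    (fun s hs => by
      have := a1 (Set.left_mem_Icc.2 zero_le_one) hs hs.1
      simp at this ⊢
      linarith)
  have := a2 (Set.left_mem_Icc.2 zero_le_one) (Set.right_mem_Icc.2 zero_le_one) zero_le_one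
  simp at this
  linarith

/-- A continuous function on a compact set: modulus of continuity in the linear form
`ε + C * dist`. -/
lemma exists_dist_le_add_mul {V W : Type*} [PseudoMetricSpace V]
    [SeminormedAddCommGroup W] {f : V → W} {Q : Set V}
    (hQ : IsCompact Q) (hf : ContinuousOn f Q) {ε : ℝ} (hε : 0 < ε) :
    ∃ C, 0 ≤ C ∧ ∀ a ∈ Q, ∀ b ∈ Q, ‖f a - f b‖ ≤ ε + C * dist a b := by
  obtain ⟨C₀, hC₀⟩ := hQ.exists_bound_of_continuousOn hf
  obtain ⟨r, hr, hru⟩ := Metric.uniformContinuousOn_iff.1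
    (hQ.uniformContinuousOn_of_continuous hf) ε hε
  -- Beyond the radius `r` of uniform continuity, this slope already exceeds the trivial bound `2 *
  -- |C₀|`.
  refine ⟨2 * |C₀| / r, by positivity, fun a ha b hb => ?_⟩
  by_cases hlt : dist a b < r
  · have := hru a ha b hb hlt
    rw [dist_eq_norm] at this
    have h2 : 0 ≤ 2 * |C₀| / r * dist a b := by positivity
    linarith
  · have h1 : ‖f a - f b‖ ≤ C₀ + C₀ :=
      (norm_sub_le (f a) (f b)).trans (add_le_add (hC₀ _ ha) (hC₀ _ hb))
    have h2 : 2 * |C₀| ≤ 2 * |C₀| / r * dist a b := by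
      rw [div_mul_eq_mul_div, le_div_iff₀ hr]
      exact mul_le_mul_of_nonneg_left (not_lt.1 hlt) (by positivity)
    linarith [le_abs_self C₀]

/-- Second order Taylor upper bound for a `C²` function, uniform on a compact convex set. -/
lemma exists_taylor_two_le {V : Type*} [NormedAddCommGroup V] [NormedSpace ℝ V]
    {f : V → ℝ} {U Q : Set V} (hU : IsOpen U) (hf : ContDiffOn ℝ 2 f U)
    (hQ : IsCompact Q) (hQc : Convex ℝ Q) (hQU : Q ⊆ U) {ε : ℝ} (hε : 0 < ε) :
    ∃ C, 0 ≤ C ∧ ∀ b ∈ Q, ∀ v, b + v ∈ Q →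
      f (b + v) ≤ f b + fderiv ℝ f b v + fderiv ℝ (fderiv ℝ f) b v v / 2
        + ε * ‖v‖ ^ 2 + C * ‖v‖ ^ 3 := by
  have hf1 : ContDiffOn ℝ 1 (fderiv ℝ f) U := hf.fderiv_of_isOpen hU (by norm_num)
  have hH : ContinuousOn (fderiv ℝ (fderiv ℝ f)) U :=
    (hf1.fderiv_of_isOpen (m := 0) hU (by norm_num)).continuousOn
  have hHQ := hH.mono hQU
  obtain ⟨C, hC, hHC⟩ := exists_dist_le_add_mul (f := fderiv ℝ (fderiv ℝ f)) hQ hHQ hε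
  refine ⟨C, hC, fun b hb v hbv => ?_⟩
  have hseg : ∀ s ∈ Set.Icc (0 : ℝ) 1, b + s • v ∈ Q := fun s hs => by
    have := hQc.add_smul_sub_mem hb hbv hs
    simpa using this
  have hline : ∀ s : ℝ, HasDerivAt (fun s : ℝ => b + s • v) v s := fun s => by
    simpa using ((hasDerivAt_id s).smul_const v).const_add b
  have hmain := le_taylor_two_of_deriv_le (φ := fun s => f (b + s • v))
    (φ' := fun s => fderiv ℝ f (b + s • v) v)
    (φ'' := fun s => fderiv ℝ (fderiv ℝ f) (b + s • v) v v)
    (B := fderiv ℝ (fderiv ℝ f) b v v + (ε + C * ‖v‖) * ‖v‖ ^ 2) ?_ ?_ ?_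
  · simp only [one_smul, zero_smul, add_zero] at hmain
    have h1 : 0 ≤ ε * ‖v‖ ^ 2 := by positivity
    have h2 : 0 ≤ C * ‖v‖ ^ 3 := by positivity
    nlinarith
  · intro s hs
    have hd : DifferentiableAt ℝ f (b + s • v) :=
      ((hf _ (hQU (hseg s hs))).contDiffAt (hU.mem_nhds (hQU (hseg s hs)))).differentiableAt
        (by norm_num)
    exact hd.hasFDerivAt.comp_hasDerivAt s (hline s)
  · intro s hs
    have hd : DifferentiableAt ℝ (fderiv ℝ f) (b + s • v) :=
      ((hf1 _ (hQU (hseg s hs))).contDiffAt (hU.mem_nhds (hQU (hseg s hs)))).differentiableAt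
        (by norm_num)
    have := hd.hasFDerivAt.comp_hasDerivAt s (hline s)
    simpa using this.clm_apply (hasDerivAt_const s v)
  · intro s hs
    set D := fderiv ℝ (fderiv ℝ f) (b + s • v) - fderiv ℝ (fderiv ℝ f) b with hD
    have hDn : ‖D‖ ≤ ε + C * ‖v‖ := by
      have h6 := hHC _ (hseg s hs) _ hb
      have h7 : dist (b + s • v) b ≤ ‖v‖ := by
        rw [dist_eq_norm, add_sub_cancel_left, norm_smul, Real.norm_of_nonneg hs.1]
        nlinarith [norm_nonneg v, hs.2]
      have h8 := mul_le_mul_of_nonneg_left h7 hC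
      linarith
    have h3 : D v v ≤ ‖D‖ * ‖v‖ * ‖v‖ :=
      (le_abs_self _).trans (D.le_opNorm₂ v v)
    have h4 : D v v = fderiv ℝ (fderiv ℝ f) (b + s • v) v v - fderiv ℝ (fderiv ℝ f) b v v := by
      simp [hD]
    have h5 : ‖D‖ * ‖v‖ * ‖v‖ ≤ (ε + C * ‖v‖) * ‖v‖ ^ 2 := by
      rw [mul_assoc, ← sq]
      exact mul_le_mul_of_nonneg_right hDn (by positivity)
    linarith

/-! ### Block smooth functions and their averages -/

/-- `G = (G_1, …, G_k)`, where the partial derivatives of `G_i` along the `i`-th block are given by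
`d` and all other partial derivatives vanish; `G` takes values in `[η, 1 - η]^k` and has first and
second order bounds controlled by `K`. -/
structure BlockSmooth {k n : ℕ} (K η : ℝ) (G : EuclideanSpace ℝ (Fin k × Fin n) → Fin k → ℝ)
    (d : EuclideanSpace ℝ (Fin k × Fin n) → Fin k → Fin n → ℝ) : Prop where
  measurable (i) : Measurable fun x => G x i
  measurable_deriv (i a) : Measurable fun x => d x i a
  mem_Icc (x i) : G x i ∈ Set.Icc η (1 - η)
  abs_deriv_le (x i a) : |d x i a| ≤ K
  taylor (x y i) : |G (x + y) i - G x i - ∑ a, d x i a * y (i, a)| ≤ K * ‖y‖ ^ 2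

section average

variable {k n : ℕ} {K η : ℝ} {G : EuclideanSpace ℝ (Fin k × Fin n) → Fin k → ℝ}
  {d : EuclideanSpace ℝ (Fin k × Fin n) → Fin k → Fin n → ℝ}

lemma BlockSmooth.measurable_pi (h : BlockSmooth K η G d) : Measurable G :=
  measurable_pi_iff.2 h.measurable

lemma integrable_of_mem_Icc {α : Type*} [MeasurableSpace α] {μ : Measure α} [IsFiniteMeasure μ]
    {f : α → ℝ} {a b : ℝ} (hf : Measurable f) (hab : ∀ x, f x ∈ Set.Icc a b) : Integrable f μ :=
  Integrable.of_mem_Icc a b hf.aemeasurable (.of_forall hab)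

lemma BlockSmooth.integrable (h : BlockSmooth K η G d)
    (μ : Measure (EuclideanSpace ℝ (Fin k × Fin n))) [IsFiniteMeasure μ] (x i) :
    Integrable (fun z => G (x + z) i) μ :=
  integrable_of_mem_Icc ((h.measurable i).comp (measurable_const_add x)) fun _ => h.mem_Icc _ i

lemma BlockSmooth.integrable_deriv (h : BlockSmooth K η G d)
    (μ : Measure (EuclideanSpace ℝ (Fin k × Fin n))) [IsFiniteMeasure μ] (x i a) :
    Integrable (fun z => d (x + z) i a) μ :=
  integrable_of_mem_Icc ((h.measurable_deriv i a).comp (measurable_const_add x))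
    fun _ => abs_le.1 (h.abs_deriv_le _ i a)

lemma integral_mem_Icc {α : Type*} [MeasurableSpace α] {μ : Measure α} [IsProbabilityMeasure μ]
    {f : α → ℝ} {a b : ℝ} (hf : Measurable f) (hab : ∀ x, f x ∈ Set.Icc a b) :
    ∫ x, f x ∂μ ∈ Set.Icc a b := by
  have hi : Integrable f μ := integrable_of_mem_Icc hf hab
  constructor
  · simpa using integral_mono (integrable_const a) hi fun x => (hab x).1
  · simpa using integral_mono hi (integrable_const b) fun x => (hab x).2

lemma measurable_integral_add {E : Type*} [AddCommGroup E] [MeasurableSpace E] [MeasurableAdd₂ E]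
    {f : E → ℝ} (hf : Measurable f) (μ : Measure E) [SFinite μ] :
    Measurable fun x => ∫ z, f (x + z) ∂μ :=
  (StronglyMeasurable.integral_prod_right (f := fun x z => f (x + z))
    (hf.comp measurable_add).stronglyMeasurable).measurable

/-- The class of block smooth functions is stable under averaging over translations. -/
lemma BlockSmooth.average (h : BlockSmooth K η G d)
    (μ : Measure (EuclideanSpace ℝ (Fin k × Fin n))) [IsProbabilityMeasure μ] :
    BlockSmooth K η (fun x i => ∫ z, G (x + z) i ∂μ) (fun x i a => ∫ z, d (x + z) i a ∂μ) where
  measurable i := measurable_integral_add (h.measurable i) μ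
  measurable_deriv i a := measurable_integral_add (h.measurable_deriv i a) μ
  mem_Icc x i := integral_mem_Icc ((h.measurable i).comp (measurable_const_add x))
    fun z => h.mem_Icc _ i
  abs_deriv_le x i a := abs_le.2 <|
    integral_mem_Icc ((h.measurable_deriv i a).comp (measurable_const_add x))
      fun z => abs_le.1 (h.abs_deriv_le _ i a)
  taylor x y i := by
    -- The Taylor remainder of the average is the average of the remainders at `x + z`, so `K` does
    -- not grow.
    have e : ∫ z, G (x + y + z) i ∂μ - ∫ z, G (x + z) i ∂μ
        - ∑ a, (∫ z, d (x + z) i a ∂μ) * y (i, a)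
        = ∫ z, (G (x + z + y) i - G (x + z) i - ∑ a, d (x + z) i a * y (i, a)) ∂μ := by
      simp_rw [← integral_mul_const]
      rw [integral_sub _ (integrable_finsetSum _ fun a _ => (h.integrable_deriv μ x i a).mul_const _),
        integral_sub _ (h.integrable μ x i),
        integral_finsetSum _ fun a _ => (h.integrable_deriv μ x i a).mul_const _]
      · simp_rw [add_right_comm x]
      · simp_rw [add_right_comm x]
        exact h.integrable μ _ i
      · refine Integrable.sub ?_ (h.integrable μ x i)
        simp_rw [add_right_comm x]
        exact h.integrable μ _ i
    rw [e, ← Real.norm_eq_abs]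
    calc _ ≤ ∫ z, K * ‖y‖ ^ 2 ∂μ := by
          refine norm_integral_le_of_norm_le (integrable_const (μ := μ) _) (.of_forall fun z => ?_)
          exact h.taylor _ _ _
      _ = _ := by simp

/-! ### Convolution powers and iteration of the step -/

/-- The `N`-fold convolution power of a measure. -/
noncomputable def convPow {E : Type*} [AddMonoid E] [MeasurableSpace E] (ν : Measure E) :
    ℕ → Measure E
  | 0 => Measure.dirac 0
  | N + 1 => convPow ν N ∗ ν

instance {E : Type*} [AddMonoid E] [MeasurableSpace E] [MeasurableAdd₂ E] (ν : Measure E)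
    [IsProbabilityMeasure ν] (N : ℕ) : IsProbabilityMeasure (convPow ν N) := by
  induction N with
  | zero => unfold convPow; infer_instance
  | succ N ih => unfold convPow; infer_instance

lemma charFun_convPow {E : Type*} [NormedAddCommGroup E] [InnerProductSpace ℝ E]
    [MeasurableSpace E] [BorelSpace E] [SecondCountableTopology E] (ν : Measure E)
    [IsProbabilityMeasure ν] (N : ℕ) (t : E) :
    charFun (convPow ν N) t = charFun ν t ^ N := by
  induction N with
  | zero => simp [convPow]
  | succ N ih => rw [convPow, charFun_conv, ih, pow_succ]

/-- Iterating a one-step estimate that is uniform over the class of block smooth functions. -/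
lemma BlockSmooth.integral_convPow_le {Ψ : (Fin k → ℝ) → ℝ} (hΨ : Measurable Ψ) {B : ℝ}
    (hΨB : ∀ x, |Ψ x| ≤ B)
    {ν : Measure (EuclideanSpace ℝ (Fin k × Fin n))} [IsProbabilityMeasure ν] {e : ℝ}
    (hstep : ∀ G d, BlockSmooth K η G d → ∀ x,
      ∫ z, Ψ (G (x + z)) ∂ν ≤ Ψ (fun i => ∫ z, G (x + z) i ∂ν) + e) (N : ℕ)
    (h : BlockSmooth K η G d) :
    ∫ z, Ψ (G z) ∂(convPow ν N) ≤ Ψ (fun i => ∫ z, G z i ∂(convPow ν N)) + N * e := by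
  have hint : ∀ {μ : Measure (EuclideanSpace ℝ (Fin k × Fin n))} [IsProbabilityMeasure μ]
      {H : EuclideanSpace ℝ (Fin k × Fin n) → Fin k → ℝ}, Measurable H →
      Integrable (fun z => Ψ (H z)) μ := fun hH =>
    integrable_of_mem_Icc (hΨ.comp hH) fun z => abs_le.1 (hΨB _)
  -- `G` must vary: the induction hypothesis is applied to the average of `G` over the last step.
  induction N generalizing G d with
  | zero =>
    simp [convPow]
  | succ N ih =>
    simp only [convPow]
    have h1 : ∀ i, ∫ z, G z i ∂(convPow ν N ∗ ν) = ∫ x, ∫ z, G (x + z) i ∂ν ∂(convPow ν N) :=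
      fun i => integral_conv
        (by simpa using h.integrable (convPow ν N ∗ ν) 0 i)
    simp_rw [h1]
    rw [integral_conv (hint h.measurable_pi)]
    have hav := h.average ν
    have h2 := ih hav
    have h3 : ∫ x, ∫ z, Ψ (G (x + z)) ∂ν ∂(convPow ν N)
        ≤ ∫ x, (Ψ (fun i => ∫ z, G (x + z) i ∂ν) + e) ∂(convPow ν N) := by
      refine integral_mono ?_ ((hint hav.measurable_pi).add (integrable_const e))
        fun x => hstep G d h x
      refine integrable_of_mem_Icc (a := -B) (b := B)
        (measurable_integral_add (hΨ.comp h.measurable_pi) ν) fun x => ?_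
      exact integral_mem_Icc ((hΨ.comp h.measurable_pi).comp (measurable_const_add x))
        fun z => abs_le.1 (hΨB _)
    rw [integral_add (hint hav.measurable_pi) (integrable_const e)] at h3
    simp only [integral_const, probReal_univ, one_smul] at h3
    push_cast
    linarith

/-- A centred Gaussian measure is the `N`-th convolution power of its rescaling by `√(1/N)`. -/
lemma convPow_map_smul_multivariateGaussian {ι : Type*} [Fintype ι] [DecidableEq ι]
    {S : Matrix ι ι ℝ} (hS : S.PosSemidef) {N : ℕ} {s : ℝ} (hs : N * s ^ 2 = 1) :
    convPow ((multivariateGaussian 0 S).map (s • ·)) N = multivariateGaussian 0 S := by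
  have : IsProbabilityMeasure ((multivariateGaussian 0 S).map (s • ·)) :=
    Measure.isProbabilityMeasure_map (by fun_prop)
  refine Measure.ext_of_charFun ?_
  ext t
  rw [charFun_convPow, charFun_map_smul, charFun_multivariateGaussian hS,
    charFun_multivariateGaussian hS, ← Complex.exp_nat_mul]
  congr 1
  have hs' : (N : ℂ) * (s : ℂ) ^ 2 = 1 := by exact_mod_cast hs
  simp only [inner_zero_right, Complex.ofReal_zero, zero_mul, zero_sub, WithLp.ofLp_smul,
    Matrix.mulVec_smul, dotProduct_smul, smul_dotProduct, smul_eq_mul, Complex.ofReal_mul]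
  linear_combination (-(((t.ofLp ⬝ᵥ S *ᵥ t.ofLp : ℝ) : ℂ)) / 2) * hs'

end average

/-! ### The one-step estimate -/

lemma bilin_apply_eq_sum {k : ℕ} (B : (Fin k → ℝ) →L[ℝ] (Fin k → ℝ) →L[ℝ] ℝ) (u : Fin k → ℝ) :
    B u u = ∑ i, ∑ j, u i * u j * B (Pi.single i 1) (Pi.single j 1) := by
  conv_lhs => rw [pi_eq_sum_univ' u]
  simp only [map_sum, map_smul, FunLike.coe_sum, FunLike.coe_smul,
    Finset.sum_apply, Pi.smul_apply, smul_eq_mul, Finset.mul_sum]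
  rw [Finset.sum_comm]
  refine Finset.sum_congr rfl fun i _ => Finset.sum_congr rfl fun j _ => ?_
  ring

/-- Since `r` is of order `s²`, replacing the increment by its linear part `s • u` changes the
quadratic term only at order `s³`. It is used with `T = 1 + ‖z‖`; the cubic term forces the power `T
^ 6`, which dominates all the others. -/
lemma one_step_pointwise {V : Type*} [NormedAddCommGroup V] [NormedSpace ℝ V]
    (B : V →L[ℝ] V →L[ℝ] ℝ) {u r : V} {A C C₀ T s ε : ℝ} (hA : 0 ≤ A) (hC : 0 ≤ C)
    (hB : ‖B‖ ≤ C₀) (hT : 1 ≤ T) (hs : 0 < s) (hs1 : s ≤ 1) (hε : 0 ≤ ε)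
    (hu : ‖u‖ ≤ A * T) (hr : ‖r‖ ≤ A * s ^ 2 * T ^ 2) :
    B (s • u + r) (s • u + r) / 2 + ε * ‖s • u + r‖ ^ 2 + C * ‖s • u + r‖ ^ 3 ≤
      s ^ 2 * B u u / 2 + (4 * A ^ 2 * ε * s ^ 2 + (2 * C₀ * A ^ 2 + 8 * C * A ^ 3) * s ^ 3)
        * T ^ 6 := by
  have hC₀ : 0 ≤ C₀ := B.opNorm_nonneg.trans hB
  have hT0 : 0 ≤ T := zero_le_one.trans hT
  have hTT : T ≤ T ^ 2 := by nlinarith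
  have hn : ‖s • u + r‖ ≤ 2 * A * s * T ^ 2 := by
    have h1 : ‖s • u‖ ≤ A * s * T ^ 2 := by
      rw [norm_smul, Real.norm_of_nonneg hs.le]
      calc s * ‖u‖ ≤ s * (A * T) := by gcongr
        _ ≤ s * (A * T ^ 2) := by gcongr
        _ = _ := by ring
    have h2 : ‖r‖ ≤ A * s * T ^ 2 := hr.trans (by gcongr; nlinarith)
    linarith [norm_add_le (s • u) r]
  have hT4 : T ^ 4 ≤ T ^ 6 := pow_le_pow_right₀ hT (by norm_num)
  have hT3 : T ^ 3 ≤ T ^ 6 := pow_le_pow_right₀ hT (by norm_num)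
  have e1 : ε * ‖s • u + r‖ ^ 2 ≤ 4 * A ^ 2 * ε * s ^ 2 * T ^ 6 :=
    calc ε * ‖s • u + r‖ ^ 2 ≤ ε * (2 * A * s * T ^ 2) ^ 2 := by gcongr
      _ = 4 * A ^ 2 * ε * s ^ 2 * T ^ 4 := by ring
      _ ≤ _ := by gcongr
  have e2 : C * ‖s • u + r‖ ^ 3 ≤ 8 * C * A ^ 3 * s ^ 3 * T ^ 6 :=
    calc C * ‖s • u + r‖ ^ 3 ≤ C * (2 * A * s * T ^ 2) ^ 3 := by gcongr
      _ = _ := by ring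
  have hBb : ∀ v w, B v w ≤ C₀ * ‖v‖ * ‖w‖ := fun v w =>
    (le_abs_self _).trans ((B.le_opNorm₂ v w).trans (by gcongr))
  have e3 : B u r ≤ C₀ * A ^ 2 * s ^ 2 * T ^ 6 :=
    calc B u r ≤ C₀ * ‖u‖ * ‖r‖ := hBb _ _
      _ ≤ C₀ * (A * T) * (A * s ^ 2 * T ^ 2) := by gcongr
      _ = C₀ * A ^ 2 * s ^ 2 * T ^ 3 := by ring
      _ ≤ _ := by gcongr
  have e4 : B r u ≤ C₀ * A ^ 2 * s ^ 2 * T ^ 6 :=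
    calc B r u ≤ C₀ * ‖r‖ * ‖u‖ := hBb _ _
      _ ≤ C₀ * (A * s ^ 2 * T ^ 2) * (A * T) := by gcongr
      _ = C₀ * A ^ 2 * s ^ 2 * T ^ 3 := by ring
      _ ≤ _ := by gcongr
  have e5 : B r r ≤ C₀ * A ^ 2 * s ^ 3 * T ^ 6 :=
    calc B r r ≤ C₀ * ‖r‖ * ‖r‖ := hBb _ _
      _ ≤ C₀ * (A * s ^ 2 * T ^ 2) * (A * s ^ 2 * T ^ 2) := by gcongr
      _ = C₀ * A ^ 2 * s ^ 4 * T ^ 4 := by ring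
      _ ≤ C₀ * A ^ 2 * s ^ 3 * T ^ 6 := by
        have : s ^ 4 ≤ s ^ 3 := pow_le_pow_of_le_one hs.le hs1 (by norm_num)
        gcongr
  have e6 : B (s • u + r) (s • u + r) = s ^ 2 * B u u + s * B u r + s * B r u + B r r := by
    simp only [map_add, map_smul, FunLike.coe_add, FunLike.coe_smul,
      Pi.add_apply, Pi.smul_apply, smul_eq_mul]
    ring
  have e7 := mul_le_mul_of_nonneg_left e3 hs.le
  have e8 := mul_le_mul_of_nonneg_left e4 hs.le
  have e9 : 0 ≤ C₀ * A ^ 2 * s ^ 3 * T ^ 6 := by positivity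
  rw [e6]
  nlinarith

section

variable {k n : ℕ} {γ : Measure (EuclideanSpace ℝ (Fin k × Fin n))}

/-- The identity factor of the covariance kills the terms with `a ≠ b`. For each `a` there remains
the quadratic form of the Hadamard product at the vector `i ↦ d i a`. -/
lemma integral_bilin_nonpos {M : Matrix (Fin k) (Fin k) ℝ}
    (hint : ∀ p q, Integrable (fun z => z p * z q) γ)
    (hcov : ∀ i a j b, ∫ z, z (i, a) * z (j, b) ∂γ = M i j * (1 : Matrix (Fin n) (Fin n) ℝ) a b)
    (B : (Fin k → ℝ) →L[ℝ] (Fin k → ℝ) →L[ℝ] ℝ)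
    (hB : (-(M ⊙ Matrix.of fun i j => B (Pi.single i 1) (Pi.single j 1))).PosSemidef)
    (d : Fin k → Fin n → ℝ) :
    Integrable (fun z => B (fun i => ∑ a, d i a * z (i, a)) (fun i => ∑ a, d i a * z (i, a))) γ ∧
    ∫ z, B (fun i => ∑ a, d i a * z (i, a)) (fun i => ∑ a, d i a * z (i, a)) ∂γ ≤ 0 := by
  have h1 : ∀ z : EuclideanSpace ℝ (Fin k × Fin n),
      B (fun i => ∑ a, d i a * z (i, a)) (fun i => ∑ a, d i a * z (i, a)) =
      ∑ i, ∑ j, ∑ a, ∑ b, (B (Pi.single i 1) (Pi.single j 1) * d i a * d j b)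
        * (z (i, a) * z (j, b)) := fun z => by
    rw [bilin_apply_eq_sum]
    refine Finset.sum_congr rfl fun i _ => Finset.sum_congr rfl fun j _ => ?_
    rw [Finset.sum_mul_sum, Finset.sum_mul]
    refine Finset.sum_congr rfl fun a _ => ?_
    rw [Finset.sum_mul]
    refine Finset.sum_congr rfl fun b _ => ?_
    ring
  have hI : ∀ i j a b, Integrable (fun z : EuclideanSpace ℝ (Fin k × Fin n) =>
      (B (Pi.single i 1) (Pi.single j 1) * d i a * d j b) * (z (i, a) * z (j, b))) γ :=
    fun i j a b => (hint _ _).const_mul _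
  simp_rw [h1]
  refine ⟨integrable_finsetSum _ fun i _ => integrable_finsetSum _ fun j _ =>
    integrable_finsetSum _ fun a _ => integrable_finsetSum _ fun b _ => hI i j a b, ?_⟩
  rw [integral_finsetSum _ fun i _ => integrable_finsetSum _ fun j _ =>
    integrable_finsetSum _ fun a _ => integrable_finsetSum _ fun b _ => hI i j a b]
  have h2 : ∀ i, ∫ z, (∑ j, ∑ a, ∑ b, (B (Pi.single i 1) (Pi.single j 1) * d i a * d j b)
        * (z (i, a) * z (j, b))) ∂γ =
      ∑ j, ∑ a, d i a * (M i j * B (Pi.single i 1) (Pi.single j 1)) * d j a := fun i => by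
    rw [integral_finsetSum _ fun j _ =>
      integrable_finsetSum _ fun a _ => integrable_finsetSum _ fun b _ => hI i j a b]
    refine Finset.sum_congr rfl fun j _ => ?_
    rw [integral_finsetSum _ fun a _ => integrable_finsetSum _ fun b _ => hI i j a b]
    refine Finset.sum_congr rfl fun a _ => ?_
    rw [integral_finsetSum _ fun b _ => hI i j a b]
    simp_rw [integral_const_mul, hcov, Matrix.one_apply]
    simp
    ring
  simp_rw [h2]
  have h3 : ∀ i, ∑ j, ∑ a, d i a * (M i j * B (Pi.single i 1) (Pi.single j 1)) * d j a =
      ∑ a, ∑ j, d i a * (M i j * B (Pi.single i 1) (Pi.single j 1)) * d j a :=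
    fun i => Finset.sum_comm
  simp_rw [h3]
  rw [Finset.sum_comm]
  refine Finset.sum_nonpos fun a _ => ?_
  have h4 := hB.dotProduct_mulVec_nonneg fun i => d i a
  simp only [dotProduct, Matrix.mulVec, Matrix.neg_apply, Matrix.hadamard_apply,
    Matrix.of_apply, Finset.mul_sum, star_trivial] at h4
  rw [← neg_nonneg, ← Finset.sum_neg_distrib]
  refine h4.trans_eq (Finset.sum_congr rfl fun i _ => ?_)
  rw [← Finset.sum_neg_distrib]
  refine Finset.sum_congr rfl fun j _ => ?_
  ring

end

lemma isOpen_openCube (k : ℕ) : IsOpen (openCube k) := by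
  have : openCube k = Set.univ.pi fun _ => Set.Ioo (0 : ℝ) 1 := by ext; simp [openCube]
  rw [this]
  exact isOpen_set_pi Set.finite_univ fun _ _ => isOpen_Ioo

section

variable {k n : ℕ} {γ : Measure (EuclideanSpace ℝ (Fin k × Fin n))} {K η : ℝ}
  {G : EuclideanSpace ℝ (Fin k × Fin n) → Fin k → ℝ}
  {d : EuclideanSpace ℝ (Fin k × Fin n) → Fin k → Fin n → ℝ}

lemma abs_sum_mul_le {k n : ℕ} {K : ℝ} {c : Fin n → ℝ} (hc : ∀ a, |c a| ≤ K)
    (z : EuclideanSpace ℝ (Fin k × Fin n)) (i : Fin k) :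
    |∑ a, c a * z (i, a)| ≤ K * n * ‖z‖ := by
  calc |∑ a, c a * z (i, a)| ≤ ∑ a, |c a * z (i, a)| := Finset.abs_sum_le_sum_abs _ _
    _ ≤ ∑ _a : Fin n, K * ‖z‖ := by
      refine Finset.sum_le_sum fun a _ => ?_
      rw [abs_mul]
      exact mul_le_mul (hc a) (PiLp.norm_apply_le z (i, a)) (abs_nonneg _)
        ((abs_nonneg _).trans (hc a))
    _ = _ := by simp; ring

/-- Decomposition of the centred increment of a block smooth function into a linear part and a
remainder of second order. -/
lemma BlockSmooth.increment_eq [IsProbabilityMeasure γ]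
    (hmom : Integrable (fun z => (1 + ‖z‖) ^ 6) γ)
    (hcoord : ∀ p, Integrable (fun z => z p) γ) (hmean : ∀ p, ∫ z, z p ∂γ = 0)
    (hK : 0 ≤ K) (h : BlockSmooth K η G d) {s : ℝ} (hs : 0 ≤ s)
    (x z : EuclideanSpace ℝ (Fin k × Fin n)) :
    ∃ r : Fin k → ℝ, ‖r‖ ≤ (K * (n + 1 + ∫ z, (1 + ‖z‖) ^ 6 ∂γ)) * s ^ 2 * (1 + ‖z‖) ^ 2 ∧
      G (x + s • z) = (fun i => ∫ z, G (x + s • z) i ∂γ)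
        + (s • (fun i => ∑ a, d x i a * z (i, a)) + r) := by
  set J := ∫ z, (1 + ‖z‖) ^ 6 ∂γ
  set ρ : EuclideanSpace ℝ (Fin k × Fin n) → Fin k → ℝ := fun z i =>
    G (x + s • z) i - G x i - s * ∑ a, d x i a * z (i, a) with hρ
  have hJ : 0 ≤ J := integral_nonneg fun z => by positivity
  have hρb : ∀ z i, |ρ z i| ≤ K * s ^ 2 * ‖z‖ ^ 2 := fun z i => by
    have := h.taylor x (s • z) i
    rw [norm_smul, Real.norm_of_nonneg hs] at this
    simp only [PiLp.smul_apply, smul_eq_mul] at this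
    simp only [hρ, Finset.mul_sum]
    convert! this using 1
    · simp_rw [mul_left_comm]
    · ring
  have hGi : ∀ i, Integrable (fun z => G (x + s • z) i) γ := fun i =>
    integrable_of_mem_Icc ((h.measurable i).comp (by fun_prop)) fun z => h.mem_Icc _ i
  have hui : ∀ i, Integrable (fun z : EuclideanSpace ℝ (Fin k × Fin n) =>
      s * ∑ a, d x i a * z (i, a)) γ := fun i =>
    (integrable_finsetSum _ fun a _ => (hcoord _).const_mul _).const_mul _
  have hρint : ∀ i, ∫ z, ρ z i ∂γ = ∫ z, G (x + s • z) i ∂γ - G x i := fun i => by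
    simp only [hρ]
    rw [integral_sub (f := fun z => G (x + s • z) i - G x i)
      ((hGi i).sub (integrable_const _)) (hui i),
      integral_sub (hGi i) (integrable_const _), integral_const_mul,
      integral_finsetSum _ fun a _ => (hcoord _).const_mul _]
    simp [integral_const_mul, hmean]
  have hρJ : ∀ i, |∫ z, ρ z i ∂γ| ≤ K * s ^ 2 * J := fun i => by
    rw [← Real.norm_eq_abs, ← integral_const_mul]
    refine norm_integral_le_of_norm_le (hmom.const_mul _) (.of_forall fun z => ?_)
    refine (hρb z i).trans ?_
    have hz := norm_nonneg z
    have h1 : ‖z‖ ^ 2 ≤ (1 + ‖z‖) ^ 6 :=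
      calc ‖z‖ ^ 2 ≤ (1 + ‖z‖) ^ 2 := by gcongr; linarith
        _ ≤ _ := pow_le_pow_right₀ (by linarith) (by norm_num)
    gcongr
  -- As `z` has mean zero, `∫ ρ` is exactly the shift from `G x` to the mean of `G (x + s • z)`.
  refine ⟨fun i => ρ z i - ∫ z, ρ z i ∂γ, ?_, ?_⟩
  · have hT : (1 : ℝ) ≤ (1 + ‖z‖) ^ 2 := one_le_pow₀ (by linarith [norm_nonneg z])
    refine (pi_norm_le_iff_of_nonneg (by positivity)).2 fun i => ?_
    have hz : ‖z‖ ^ 2 ≤ (1 + ‖z‖) ^ 2 := by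
      have := norm_nonneg z
      gcongr; linarith
    calc |ρ z i - ∫ z, ρ z i ∂γ| ≤ |ρ z i| + |∫ z, ρ z i ∂γ| := abs_sub _ _
      _ ≤ K * s ^ 2 * ‖z‖ ^ 2 + K * s ^ 2 * J := add_le_add (hρb z i) (hρJ i)
      _ ≤ K * s ^ 2 * (1 + ‖z‖) ^ 2 + K * s ^ 2 * J * (1 + ‖z‖) ^ 2 := by
        exact add_le_add (mul_le_mul_of_nonneg_left hz (by positivity))
          (le_mul_of_one_le_right (by positivity) hT)
      _ ≤ (K * (n + 1 + J)) * s ^ 2 * (1 + ‖z‖) ^ 2 := by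
        have : 0 ≤ K * n * s ^ 2 * (1 + ‖z‖) ^ 2 := by positivity
        linarith
  · ext i
    simp only [Pi.add_apply, Pi.smul_apply, smul_eq_mul, hρint]
    simp only [hρ]
    ring

/-- One small Gaussian step: averaging decreases `Ψ ∘ G` up to an error `o(s²)` that is uniform
over the class of block smooth functions. -/
lemma BlockSmooth.exists_one_step [IsProbabilityMeasure γ] {M : Matrix (Fin k) (Fin k) ℝ}
    (hmom : Integrable (fun z => (1 + ‖z‖) ^ 6) γ)
    (hcoord : ∀ p, Integrable (fun z => z p) γ) (hmean : ∀ p, ∫ z, z p ∂γ = 0)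
    (hint : ∀ p q, Integrable (fun z => z p * z q) γ)
    (hcov : ∀ i a j b, ∫ z, z (i, a) * z (j, b) ∂γ = M i j * (1 : Matrix (Fin n) (Fin n) ℝ) a b)
    {Ψ : (Fin k → ℝ) → ℝ} (hΨm : Measurable Ψ) {B : ℝ} (hΨB : ∀ x, |Ψ x| ≤ B)
    (hΨdiff : ContDiffOn ℝ 2 Ψ (openCube k))
    (hΨ : ∀ x ∈ openCube k, (-(M ⊙ hessianMatrix Ψ x)).PosSemidef)
    (hK : 0 ≤ K) (hη : 0 < η) {ε : ℝ} (hε : 0 < ε) :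
    ∃ r > 0, ∀ s, 0 < s → s < r → ∀ G d, BlockSmooth K η G d →
      ∀ x : EuclideanSpace ℝ (Fin k × Fin n),
      ∫ z, Ψ (G (x + s • z)) ∂γ ≤ Ψ (fun i => ∫ z, G (x + s • z) i ∂γ) + s ^ 2 * ε := by
  set Q : Set (Fin k → ℝ) := Set.univ.pi fun _ => Set.Icc η (1 - η) with hQdef
  have hQ : IsCompact Q := isCompact_univ_pi fun _ => isCompact_Icc
  have hQc : Convex ℝ Q := convex_pi fun _ _ => convex_Icc _ _
  have hQU : Q ⊆ openCube k := fun x hx i => by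
    have := hx i trivial
    exact ⟨hη.trans_le this.1, this.2.trans_lt (by linarith)⟩
  have hU := isOpen_openCube k
  have hH : ContinuousOn (fderiv ℝ (fderiv ℝ Ψ)) Q :=
    (((hΨdiff.fderiv_of_isOpen (m := 1) hU (by norm_num)).fderiv_of_isOpen (m := 0) hU
      (by norm_num)).continuousOn).mono hQU
  obtain ⟨C₀, hC₀⟩ := hQ.exists_bound_of_continuousOn (f := fderiv ℝ (fderiv ℝ Ψ)) hH
  set J := ∫ z, (1 + ‖z‖) ^ 6 ∂γ with hJdef
  have hJ : 0 ≤ J := integral_nonneg fun z => by positivity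
  set A := K * (n + 1 + J) with hAdef
  have hA : 0 ≤ A := by positivity
  have hKA : K * n ≤ A := mul_le_mul_of_nonneg_left (by linarith) hK
  clear_value A
  -- Half of `ε` pays for the `s²` error, through `ε₁`; the other half pays for the `s³` error,
  -- through the bound on `s` below. The added ones avoid division by zero.
  set ε₁ := ε / (2 * (4 * A ^ 2 + 1) * (J + 1)) with hε₁def
  have hε₁ : 0 < ε₁ := by positivity
  obtain ⟨C, hC, hTaylor⟩ := exists_taylor_two_le hU hΨdiff hQ hQc hQU hε₁
  set c := 2 * |C₀| * A ^ 2 + 8 * C * A ^ 3 with hc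
  have hc0 : 0 ≤ c := by positivity
  refine ⟨min 1 (ε / (2 * (c + 1) * (J + 1))), by positivity, fun s hs hsr G d h x => ?_⟩
  have hs1 : s ≤ 1 := (hsr.trans_le (min_le_left _ _)).le
  have hs2 : s ≤ ε / (2 * (c + 1) * (J + 1)) := (hsr.trans_le (min_le_right _ _)).le
  set b : Fin k → ℝ := fun i => ∫ z, G (x + s • z) i ∂γ with hb
  have hGi : ∀ i, Measurable fun z : EuclideanSpace ℝ (Fin k × Fin n) => G (x + s • z) i :=
    fun i => (h.measurable i).comp (by fun_prop)
  have hbQ : b ∈ Q := fun i _ => integral_mem_Icc (hGi i) fun z => h.mem_Icc _ i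
  set H := fderiv ℝ (fderiv ℝ Ψ) b with hHdef
  obtain ⟨hquadi, hquad⟩ := integral_bilin_nonpos hint hcov H (hΨ b (hQU hbQ)) (d x)
  set L := fderiv ℝ Ψ b
  have hpt : ∀ z, Ψ (G (x + s • z)) ≤ Ψ b + L (G (x + s • z) - b)
      + (s ^ 2 / 2 * H (fun i => ∑ a, d x i a * z (i, a)) (fun i => ∑ a, d x i a * z (i, a))
      + (4 * A ^ 2 * ε₁ * s ^ 2 + c * s ^ 3) * (1 + ‖z‖) ^ 6) := fun z => by
    obtain ⟨r, hr, hGr⟩ := h.increment_eq hmom hcoord hmean hK hs.le x z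
    have h1 : G (x + s • z) ∈ Q := fun i _ => h.mem_Icc _ i
    have hT := hTaylor b hbQ (G (x + s • z) - b) (by simpa using h1)
    rw [add_sub_cancel] at hT
    have hv : G (x + s • z) - b = s • (fun i => ∑ a, d x i a * z (i, a)) + r := by
      rw [hGr]; simp [hb]
    have hu : ‖fun i => ∑ a, d x i a * z (i, a)‖ ≤ A * (1 + ‖z‖) := by
      refine (pi_norm_le_iff_of_nonneg (by positivity)).2 fun i => ?_
      refine (abs_sum_mul_le (h.abs_deriv_le x i) z i).trans ?_
      have hz := norm_nonneg z
      exact mul_le_mul hKA (by linarith) hz hA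
    have h2 := one_step_pointwise H hA hC ((hC₀ b hbQ).trans (le_abs_self _))
      (by linarith [norm_nonneg z]) hs hs1 hε₁.le hu
      (by rw [hAdef]; exact hr)
    rw [← hv] at h2
    linarith
  have hLi : ∀ z, L (G (x + s • z) - b) = ∑ i, (G (x + s • z) i - b i) * L (Pi.single i 1) :=
    fun z => by
      conv_lhs => rw [pi_eq_sum_univ' (G (x + s • z) - b)]
      simp
  have hGint : ∀ i, Integrable (fun z => G (x + s • z) i) γ := fun i =>
    integrable_of_mem_Icc (hGi i) fun z => h.mem_Icc _ i
  have hDi : ∀ i, Integrable (fun z => (G (x + s • z) i - b i) * L (Pi.single i 1)) γ := fun i =>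
    ((hGint i).sub (integrable_const _)).mul_const _
  have hLint : Integrable (fun z => L (G (x + s • z) - b)) γ := by
    simp_rw [hLi]
    exact integrable_finsetSum _ fun i _ => hDi i
  -- This is why the expansion is made about the mean `b` and not about `G x`.
  have hL0 : ∫ z, L (G (x + s • z) - b) ∂γ = 0 := by
    simp_rw [hLi]
    rw [integral_finsetSum _ fun i _ => hDi i]
    refine Finset.sum_eq_zero fun i _ => ?_
    rw [integral_mul_const, integral_sub (hGint i) (integrable_const _)]
    simp [hb]
  set q : EuclideanSpace ℝ (Fin k × Fin n) → ℝ := fun z =>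
    H (fun i => ∑ a, d x i a * z (i, a)) (fun i => ∑ a, d x i a * z (i, a))
  set R := 4 * A ^ 2 * ε₁ * s ^ 2 + c * s ^ 3 with hR
  have hrhs1 : Integrable (fun z => Ψ b + L (G (x + s • z) - b)) γ :=
    (integrable_const _).add hLint
  have hrhs2 : Integrable (fun z => s ^ 2 / 2 * q z + R * (1 + ‖z‖) ^ 6) γ :=
    (hquadi.const_mul _).add (hmom.const_mul _)
  have hmono : ∫ z, Ψ (G (x + s • z)) ∂γ ≤
      ∫ z, (Ψ b + L (G (x + s • z) - b) + (s ^ 2 / 2 * q z + R * (1 + ‖z‖) ^ 6)) ∂γ :=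
    integral_mono (integrable_of_mem_Icc (hΨm.comp (measurable_pi_iff.2 hGi))
      fun z => abs_le.1 (hΨB _)) (hrhs1.add hrhs2) hpt
  rw [integral_add hrhs1 hrhs2, integral_add (integrable_const _) hLint, hL0,
    integral_add (hquadi.const_mul _) (hmom.const_mul _), integral_const_mul,
    integral_const_mul, ← hJdef] at hmono
  simp only [integral_const, probReal_univ, one_smul, add_zero] at hmono
  have hq : s ^ 2 / 2 * ∫ z, q z ∂γ ≤ 0 :=
    mul_nonpos_of_nonneg_of_nonpos (by positivity) hquad
  have h1 : 4 * A ^ 2 * ε₁ * J ≤ ε / 2 := by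
    have : (4 * A ^ 2 + 1) * (J + 1) * ε₁ = ε / 2 := by rw [hε₁def]; field_simp
    rw [← this]
    have : 0 ≤ (4 * A ^ 2 + J + 1) * ε₁ := by positivity
    nlinarith
  have h2 : c * s * J ≤ ε / 2 := by
    rw [le_div_iff₀ (by positivity)] at hs2
    have : 0 ≤ (c + J + 1) * s := by positivity
    nlinarith
  have h3 : R * J ≤ s ^ 2 * ε := by
    have : R * J = s ^ 2 * (4 * A ^ 2 * ε₁ * J + c * s * J) := by rw [hR]; ring
    rw [this]
    gcongr
    linarith
  linarith

end

/-! ### Moments of the Gaussian measure -/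

section

variable {ι : Type*} [Fintype ι] [DecidableEq ι] {S : Matrix ι ι ℝ}

lemma memLp_eval_multivariateGaussian (p : ι) :
    MemLp (fun z : EuclideanSpace ℝ ι => z p) 2 (multivariateGaussian 0 S) :=
  (EuclideanSpace.proj (𝕜 := ℝ) p).comp_memLp' IsGaussian.memLp_two_id

lemma integrable_eval_multivariateGaussian (p : ι) :
    Integrable (fun z : EuclideanSpace ℝ ι => z p) (multivariateGaussian 0 S) :=
  (memLp_eval_multivariateGaussian p).integrable (by norm_num)

lemma integral_eval_multivariateGaussian (p : ι) :
    ∫ z : EuclideanSpace ℝ ι, z p ∂(multivariateGaussian 0 S) = 0 := by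
  have := (EuclideanSpace.proj (𝕜 := ℝ) p).integral_comp_comm
    (IsGaussian.integrable_fun_id (μ := multivariateGaussian 0 S))
  simpa using this

lemma integral_eval_mul_eval_multivariateGaussian (hS : S.PosSemidef) (p q : ι) :
    ∫ z : EuclideanSpace ℝ ι, z p * z q ∂(multivariateGaussian 0 S) = S p q := by
  have := covariance_eval_multivariateGaussian (μ := 0) hS p q
  rw [covariance_eq_sub (memLp_eval_multivariateGaussian p) (memLp_eval_multivariateGaussian q),
    integral_eval_multivariateGaussian] at this
  simpa using this

lemma integrable_one_add_norm_pow_multivariateGaussian (m : ℕ) :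
    Integrable (fun z : EuclideanSpace ℝ ι => (1 + ‖z‖) ^ m) (multivariateGaussian 0 S) := by
  have h0 : MemLp (fun z : EuclideanSpace ℝ ι => ‖z‖) m (multivariateGaussian 0 S) :=
    (IsGaussian.memLp_id (multivariateGaussian 0 S) m (by simp)).norm
  have h1 : MemLp (fun z : EuclideanSpace ℝ ι => 1 + ‖z‖) m (multivariateGaussian 0 S) :=
    MemLp.add (memLp_const (1 : ℝ)) h0
  have h2 : ∀ z : EuclideanSpace ℝ ι, ‖1 + ‖z‖‖ = 1 + ‖z‖ := fun z =>
    Real.norm_of_nonneg (by positivity)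
  have h3 : Integrable (fun z : EuclideanSpace ℝ ι => ‖1 + ‖z‖‖ ^ m)
    (multivariateGaussian 0 S) := h1.integrable_norm_pow'
  simpa only [h2] using h3

end

/-! ### From one step to the full Gaussian -/

/-- The inequality for block smooth functions. -/
lemma BlockSmooth.integral_le {k n : ℕ} {K η : ℝ}
    {G : EuclideanSpace ℝ (Fin k × Fin n) → Fin k → ℝ}
    {d : EuclideanSpace ℝ (Fin k × Fin n) → Fin k → Fin n → ℝ} {M : Matrix (Fin k) (Fin k) ℝ}
    (hM : M.PosSemidef) {Ψ : (Fin k → ℝ) → ℝ} (hΨm : Measurable Ψ) {B : ℝ} (hΨB : ∀ x, |Ψ x| ≤ B)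
    (hΨdiff : ContDiffOn ℝ 2 Ψ (openCube k))
    (hΨ : ∀ x ∈ openCube k, (-(M ⊙ hessianMatrix Ψ x)).PosSemidef)
    (hK : 0 ≤ K) (hη : 0 < η) (h : BlockSmooth K η G d) :
    ∫ z, Ψ (G z) ∂(multivariateGaussian 0 (M ⊗ₖ (1 : Matrix (Fin n) (Fin n) ℝ))) ≤
      Ψ (fun i => ∫ z, G z i ∂(multivariateGaussian 0 (M ⊗ₖ (1 : Matrix (Fin n) (Fin n) ℝ)))) := by
  have hS : (M ⊗ₖ (1 : Matrix (Fin n) (Fin n) ℝ)).PosSemidef := hM.kronecker Matrix.PosSemidef.one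
  set γ := multivariateGaussian 0 (M ⊗ₖ (1 : Matrix (Fin n) (Fin n) ℝ)) with hγ
  refine le_of_forall_pos_le_add fun ε hε => ?_
  obtain ⟨r, hr, hstep⟩ := BlockSmooth.exists_one_step (γ := γ)
    (integrable_one_add_norm_pow_multivariateGaussian 6) integrable_eval_multivariateGaussian
    integral_eval_multivariateGaussian
    (fun p q => (memLp_eval_multivariateGaussian p).integrable_mul
      (memLp_eval_multivariateGaussian q))
    (fun i a j b => by
      rw [hγ, integral_eval_mul_eval_multivariateGaussian hS, Matrix.kroneckerMap_apply])
    hΨm hΨB hΨdiff hΨ hK hη hε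
  -- With `s = √(1/N) < r`, the total error `N * (s ^ 2 * ε)` is exactly `ε`.
  obtain ⟨N, hN⟩ := exists_nat_gt (1 / r ^ 2)
  have hN0 : (0 : ℝ) < N := lt_trans (by positivity) hN
  set s := √(1 / N) with hs
  have hs0 : 0 < s := Real.sqrt_pos.2 (by positivity)
  have hs2 : s ^ 2 = 1 / N := Real.sq_sqrt (by positivity)
  have hNs : N * s ^ 2 = 1 := by rw [hs2]; field_simp
  have hsr : s < r := by
    refine lt_of_pow_lt_pow_left₀ 2 hr.le ?_
    rw [hs2, one_div_lt hN0 (by positivity)]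
    exact hN
  have hmeas : Measurable fun z : EuclideanSpace ℝ (Fin k × Fin n) => s • z := by fun_prop
  have : IsProbabilityMeasure (γ.map (s • ·)) :=
    Measure.isProbabilityMeasure_map hmeas.aemeasurable
  have key := BlockSmooth.integral_convPow_le (K := K) (η := η) (ν := γ.map (s • ·))
    (e := s ^ 2 * ε) hΨm hΨB (fun G d h x => ?_) N h
  · rw [convPow_map_smul_multivariateGaussian hS hNs, ← mul_assoc, hNs, one_mul] at key
    exact key
  · have hx := measurable_const_add x
    have h1 : ∫ z, Ψ (G (x + z)) ∂(γ.map (s • ·)) = ∫ z, Ψ (G (x + s • z)) ∂γ :=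
      integral_map hmeas.aemeasurable
        ((hΨm.comp h.measurable_pi).comp hx).aestronglyMeasurable
    have h2 : ∀ i, ∫ z, G (x + z) i ∂(γ.map (s • ·)) = ∫ z, G (x + s • z) i ∂γ := fun i =>
      integral_map hmeas.aemeasurable ((h.measurable i).comp hx).aestronglyMeasurable
    simp_rw [h1, h2]
    exact hstep s hs0 hsr G d h x

/-! ### Smooth approximation of measurable functions -/

/-- First order Taylor estimate for a function with Lipschitz derivative. -/
lemma norm_taylor_one_le_of_lipschitz {V : Type*} [NormedAddCommGroup V] [NormedSpace ℝ V]
    {g : V → ℝ} (hg : Differentiable ℝ g) {C : NNReal} (hC : LipschitzWith C (fderiv ℝ g))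
    (x y : V) : |g (x + y) - g x - fderiv ℝ g x y| ≤ C * ‖y‖ ^ 2 := by
  have := (convex_closedBall x ‖y‖).norm_image_sub_le_of_norm_fderiv_le' (f := g) (𝕜 := ℝ)
    (φ := fderiv ℝ g x) (C := C * ‖y‖) (x := x) (y := x + y)
    (fun z _ => hg z) (fun z hz => ?_) (by simp) (by simp)
  · rw [add_sub_cancel_left] at this
    rw [sq, ← mul_assoc]
    exact this
  · refine (hC.norm_sub_le z x).trans ?_
    gcongr
    simpa [dist_eq_norm] using hz

/-- Approximation in `L¹` of a `[0, 1]`-valued measurable function by smooth functions with values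
in `[η, 1 - η]` and bounded first and second derivatives. -/
lemma exists_smooth_approx {V : Type*} [NormedAddCommGroup V] [NormedSpace ℝ V]
    [FiniteDimensional ℝ V] [MeasurableSpace V] [BorelSpace V] (μ : Measure V)
    [IsProbabilityMeasure μ] {f : V → ℝ} (hf : Measurable f) (hf01 : ∀ x, f x ∈ Set.Icc (0 : ℝ) 1)
    {η : ℝ} (hη : 0 < η) (hη' : η ≤ 1 / 4) :
    ∃ (g : V → ℝ) (K : ℝ), 0 ≤ K ∧ ContDiff ℝ 1 g ∧ (∀ x, g x ∈ Set.Icc η (1 - η)) ∧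
      (∀ x, ‖fderiv ℝ g x‖ ≤ K) ∧ (∀ x y, |g (x + y) - g x - fderiv ℝ g x y| ≤ K * ‖y‖ ^ 2) ∧
      ∫ x, |f x - g x| ∂μ ≤ 8 * η := by
  have hfi : Integrable f μ := integrable_of_mem_Icc hf hf01
  obtain ⟨u, hu, hfu, huc, hui⟩ := hfi.exists_hasCompactSupport_integral_sub_le hη
  -- The range is `[0, 1 - 4η]`; an `η`-approximation `w` lies in `[-η, 1 - 3η]`, and adding `2η`
  -- gives `[η, 1 - η]`. Clipping keeps the compact support, which later bounds the derivatives of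
  -- `w`.
  set v : V → ℝ := fun x => (1 - 4 * η) * max 0 (min (u x) 1) with hv
  have hvc : Continuous v := by fun_prop
  have hvs : HasCompactSupport v := hu.comp_left (g := fun t => (1 - 4 * η) * max 0 (min t 1))
    (by simp)
  obtain ⟨w, hw, hwv, hws⟩ := hvc.exists_contDiff_approx 2 (ε := fun _ => η) continuous_const
    fun _ => hη
  have hwc : HasCompactSupport w := hvs.mono hws
  have hclip : ∀ x, 0 ≤ max 0 (min (u x) 1) ∧ max 0 (min (u x) 1) ≤ 1 := fun x =>
    ⟨le_max_left _ _, max_le zero_le_one (min_le_right _ _)⟩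
  have hwv' : ∀ x, |w x - (1 - 4 * η) * max 0 (min (u x) 1)| < η := fun x => hwv x
  have hd : ContDiff ℝ 1 (fderiv ℝ w) := hw.fderiv_right (by norm_num)
  have hds : HasCompactSupport (fderiv ℝ w) := hwc.fderiv ℝ
  obtain ⟨C₁, hC₁⟩ := hd.continuous.bounded_above_of_compact_support hds
  obtain ⟨C₂, hC₂⟩ := hd.lipschitzWith_of_hasCompactSupport hds (by norm_num)
  have hfd : ∀ x, fderiv ℝ (fun x => 2 * η + w x) x = fderiv ℝ w x := fun x => by
    rw [fderiv_const_add]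
  refine ⟨fun x => 2 * η + w x, |C₁| + C₂, by positivity,
    contDiff_const.add (hw.of_le (by norm_num)), fun x => ?_, fun x => ?_, fun x y => ?_, ?_⟩
  · have h1 := abs_lt.1 (hwv' x)
    obtain ⟨h2, h3⟩ := hclip x
    constructor <;> nlinarith
  · rw [hfd]
    exact (hC₁ x).trans ((le_abs_self _).trans (by simp))
  · rw [hfd, add_sub_add_left_eq_sub]
    refine (norm_taylor_one_le_of_lipschitz (hw.differentiable (by norm_num)) hC₂ x y).trans ?_
    gcongr
    simp
  -- The `7η` is `4η` from the scaling, `η` from smoothing and `2η` from the shift. Clipping `u` to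
  -- `[0, 1]` does not move it away from `f`.
  · have hpt : ∀ x, |f x - (2 * η + w x)| ≤ ‖f x - u x‖ + 7 * η := fun x => by
      have h1 := abs_lt.1 (hwv' x)
      obtain ⟨h2, h3⟩ := hclip x
      have h4 : |f x - max 0 (min (u x) 1)| ≤ ‖f x - u x‖ := by
        rw [Real.norm_eq_abs]
        obtain ⟨h5, h6⟩ := hf01 x
        rcases le_total (u x) 1 with h7 | h7
        · rw [min_eq_left h7]
          rcases le_total 0 (u x) with h8 | h8
          · rw [max_eq_right h8]
          · rw [max_eq_left h8, abs_of_nonneg (by linarith), abs_of_nonneg (by linarith)]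
            linarith
        · rw [min_eq_right h7, max_eq_right zero_le_one, abs_of_nonpos (by linarith),
            abs_of_nonpos (by linarith)]
          linarith
      have h9 := abs_le.1 h4
      refine abs_le.2 ⟨?_, ?_⟩ <;> nlinarith
    have hb' : Integrable (fun x => ‖f x - u x‖) μ := (hfi.sub hui).norm
    have hb : Integrable (fun x => ‖f x - u x‖ + 7 * η) μ := hb'.add (integrable_const _)
    have hmono := integral_mono_of_nonneg (.of_forall fun x => abs_nonneg _) hb
      (.of_forall hpt)
    rw [integral_add hb' (integrable_const _)] at hmono
    simp only [integral_const, probReal_univ, one_smul] at hmono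
    linarith

/-! ### Separate blocks and passage to measurable `F` -/

section

variable {k n : ℕ}

lemma measurable_block (i : Fin k) :
    Measurable fun x : EuclideanSpace ℝ (Fin k × Fin n) => block x i := by
  unfold block
  fun_prop

lemma block_add (x y : EuclideanSpace ℝ (Fin k × Fin n)) (i : Fin k) :
    block (x + y) i = block x i + block y i := rfl

lemma norm_block_le (x : EuclideanSpace ℝ (Fin k × Fin n)) (i : Fin k) : ‖block x i‖ ≤ ‖x‖ := by
  rw [← sq_le_sq₀ (norm_nonneg _) (norm_nonneg _), EuclideanSpace.real_norm_sq_eq,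
    EuclideanSpace.real_norm_sq_eq, Fintype.sum_prod_type]
  exact Finset.single_le_sum (f := fun i => ∑ a, x (i, a) ^ 2)
    (fun j _ => Finset.sum_nonneg fun a _ => sq_nonneg _) (Finset.mem_univ i)

lemma measurable_blockEval {F : EuclideanSpace ℝ (Fin n) → Fin k → ℝ} (hF : Measurable F) :
    Measurable (blockEval F) :=
  measurable_pi_iff.2 fun i => (measurable_pi_iff.1 hF i).comp (measurable_block i)

/-- A family of smooth functions of the separate blocks is block smooth. -/
lemma blockSmooth_of_contDiff {g : Fin k → EuclideanSpace ℝ (Fin n) → ℝ} {K η : ℝ}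
    (hg : ∀ i, ContDiff ℝ 1 (g i)) (hmem : ∀ i x, g i x ∈ Set.Icc η (1 - η))
    (hd : ∀ i x, ‖fderiv ℝ (g i) x‖ ≤ K)
    (ht : ∀ i x y, |g i (x + y) - g i x - fderiv ℝ (g i) x y| ≤ K * ‖y‖ ^ 2) :
    BlockSmooth K η (fun x i => g i (block x i))
      (fun (x : EuclideanSpace ℝ (Fin k × Fin n)) i a =>
        fderiv ℝ (g i) (block x i) (EuclideanSpace.single a 1)) where
  measurable i := (hg i).continuous.measurable.comp (measurable_block i)
  measurable_deriv i a :=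
    (measurable_fderiv_apply_const ℝ (g i) (EuclideanSpace.single a 1)).comp (measurable_block i)
  mem_Icc x i := hmem i _
  abs_deriv_le x i a := by
    refine ((fderiv ℝ (g i) (block x i)).le_opNorm _).trans ?_
    simpa using hd i _
  taylor x y i := by
    have h1 : fderiv ℝ (g i) (block x i) (block y i) =
        ∑ a, fderiv ℝ (g i) (block x i) (EuclideanSpace.single a 1) * y (i, a) := by
      have h2 : block y i = ∑ a, y (i, a) • EuclideanSpace.single a (1 : ℝ) := by
        conv_lhs => rw [← (EuclideanSpace.basisFun (Fin n) ℝ).sum_repr (block y i)]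
        simp [block]
      rw [h2]
      simp [mul_comm]
    rw [← h1, block_add]
    have hK : 0 ≤ K := (norm_nonneg _).trans (hd i (block x i))
    refine (ht i _ _).trans ?_
    gcongr
    exact norm_block_le y i

lemma isCompact_closedCube (k : ℕ) : IsCompact (closedCube k) := by
  have : closedCube k = Set.univ.pi fun _ => Set.Icc (0 : ℝ) 1 := by
    ext x
    simp only [closedCube, Set.mem_univ_pi, Set.mem_ofPred_eq]
  rw [this]
  exact isCompact_univ_pi fun _ => isCompact_Icc

lemma openCube_subset_closedCube (k : ℕ) : openCube k ⊆ closedCube k :=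
  fun _ hx i => Set.Ioo_subset_Icc_self (hx i)

/-- The inequality for a Gaussian vector given by its law and `Ψ` continuous and bounded on the
whole space. -/
lemma integral_blockEval_le {M : Matrix (Fin k) (Fin k) ℝ} (hM : M.PosSemidef)
    {Ψ : (Fin k → ℝ) → ℝ} (hΨc : Continuous Ψ) {B : ℝ} (hΨB : ∀ x, |Ψ x| ≤ B)
    (hΨdiff : ContDiffOn ℝ 2 Ψ (openCube k))
    (hΨ : ∀ x ∈ openCube k, (-(M ⊙ hessianMatrix Ψ x)).PosSemidef)
    {F : EuclideanSpace ℝ (Fin n) → Fin k → ℝ}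
    (hFmeas : Measurable F) (hFcube : ∀ y, F y ∈ closedCube k) :
    ∫ z, Ψ (blockEval F z) ∂(multivariateGaussian 0 (M ⊗ₖ (1 : Matrix (Fin n) (Fin n) ℝ))) ≤
      Ψ (fun i => ∫ z, F (block z i) i
        ∂(multivariateGaussian 0 (M ⊗ₖ (1 : Matrix (Fin n) (Fin n) ℝ)))) := by
  set γ := multivariateGaussian 0 (M ⊗ₖ (1 : Matrix (Fin n) (Fin n) ℝ)) with hγ
  refine le_of_forall_pos_le_add fun ε hε => ?_
  obtain ⟨C, hC, hmod⟩ := exists_dist_le_add_mul (isCompact_closedCube k)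
    hΨc.continuousOn (show 0 < ε / 4 by positivity)
  -- Passing from `F` to `g` costs `ε / 4 + C * (k * (8 * η)) ≤ ε / 2`, and is done twice: inside
  -- the integral and at the means.
  set η := min (1 / 4) (ε / (32 * (C * k + 1))) with hη
  have hη0 : 0 < η := by positivity
  have hη2 : C * (k * (8 * η)) ≤ ε / 4 := by
    have h1 : η ≤ ε / (32 * (C * k + 1)) := min_le_right _ _
    rw [le_div_iff₀ (by positivity)] at h1
    nlinarith
  have hFi : ∀ i, Measurable fun y => F y i := measurable_pi_iff.1 hFmeas
  have hprob : ∀ i, IsProbabilityMeasure (γ.map fun z => block z i) := fun i =>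
    Measure.isProbabilityMeasure_map (measurable_block i).aemeasurable
  choose g K hK hgc hgm hgd hgt hgF using fun i =>
    exists_smooth_approx (γ.map fun z => block z i) (hFi i) (fun y => hFcube y i) hη0
      (min_le_left _ _)
  have hKle : ∀ i, K i ≤ ∑ j, K j := fun i =>
    Finset.single_le_sum (fun j _ => hK j) (Finset.mem_univ i)
  have hG := blockSmooth_of_contDiff hgc hgm (fun i x => (hgd i x).trans (hKle i))
    (fun i x y => (hgt i x y).trans (mul_le_mul_of_nonneg_right (hKle i) (by positivity)))
  have hmain := hG.integral_le hM hΨc.measurable hΨB hΨdiff hΨ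
    (Finset.sum_nonneg fun j _ => hK j) hη0
  rw [← hγ] at hmain
  have hgmeas : ∀ i, Measurable fun z : EuclideanSpace ℝ (Fin k × Fin n) => g i (block z i) :=
    hG.measurable
  have hFmeas' : ∀ i, Measurable fun z : EuclideanSpace ℝ (Fin k × Fin n) => F (block z i) i :=
    fun i => (hFi i).comp (measurable_block i)
  have hgint : ∀ i, Integrable (fun z => g i (block z i)) γ := fun i =>
    integrable_of_mem_Icc (hgmeas i) fun z => hgm i _
  have hFint : ∀ i, Integrable (fun z => F (block z i) i) γ := fun i =>
    integrable_of_mem_Icc (hFmeas' i) fun z => hFcube _ i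
  have hdint : ∀ i, Integrable (fun z => |F (block z i) i - g i (block z i)|) γ := fun i =>
    ((hFint i).sub (hgint i)).abs
  have hd : ∀ i, ∫ z, |F (block z i) i - g i (block z i)| ∂γ ≤ 8 * η := fun i => by
    have h1 := hgF i
    have h2 : Measurable fun y => |F y i - g i y| :=
      ((hFi i).sub (hgc i).continuous.measurable).abs
    rwa [integral_map (measurable_block i).aemeasurable h2.aestronglyMeasurable] at h1
  have hsum : ∑ i, ∫ z, |F (block z i) i - g i (block z i)| ∂γ ≤ k * (8 * η) := by
    simpa using Finset.sum_le_sum fun i (_ : i ∈ Finset.univ) => hd i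
  -- A modulus linear in the distance can be integrated, so `L¹` closeness of the components
  -- suffices.
  have hmod' : ∀ a ∈ closedCube k, ∀ b ∈ closedCube k,
      Ψ a ≤ Ψ b + (ε / 4 + C * ∑ i, |a i - b i|) := fun a ha b hb => by
    have h1 := le_of_abs_le (hmod a ha b hb)
    have h2 : dist a b ≤ ∑ i, |a i - b i| :=
      (dist_pi_le_iff (Finset.sum_nonneg fun i _ => abs_nonneg _)).2 fun i =>
        Finset.single_le_sum (f := fun i => |a i - b i|) (fun j _ => abs_nonneg _)
          (Finset.mem_univ i)
    have h3 := mul_le_mul_of_nonneg_left h2 hC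
    linarith
  have hgcube : ∀ z : EuclideanSpace ℝ (Fin k × Fin n),
      (fun i => g i (block z i)) ∈ closedCube k := fun z i =>
    ⟨hη0.le.trans (hgm i _).1, (hgm i _).2.trans (by linarith)⟩
  have h1 : ∫ z, Ψ (blockEval F z) ∂γ ≤
      ∫ z, Ψ (fun i => g i (block z i)) ∂γ + (ε / 4 + C * (k * (8 * η))) := by
    have hi1 : Integrable (fun z => Ψ (fun i => g i (block z i))) γ :=
      integrable_of_mem_Icc (hΨc.measurable.comp hG.measurable_pi) fun z => abs_le.1 (hΨB _)
    have hi2 : Integrable (fun z => ∑ i, |F (block z i) i - g i (block z i)|) γ :=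
      integrable_finsetSum _ fun i _ => hdint i
    have hi3 : Integrable (fun z => ε / 4 + C * ∑ i, |F (block z i) i - g i (block z i)|) γ :=
      (integrable_const _).add (hi2.const_mul _)
    have h2 : ∫ z, Ψ (blockEval F z) ∂γ ≤ ∫ z, (Ψ (fun i => g i (block z i)) +
        (ε / 4 + C * ∑ i, |F (block z i) i - g i (block z i)|)) ∂γ :=
      integral_mono (integrable_of_mem_Icc (hΨc.measurable.comp (measurable_blockEval hFmeas))
        fun z => abs_le.1 (hΨB _)) (hi1.add hi3)
        fun z => hmod' _ (fun i => hFcube _ i) _ (hgcube z)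
    rw [integral_add hi1 hi3, integral_add (integrable_const _) (hi2.const_mul _),
      integral_const_mul, integral_finsetSum _ fun i _ => hdint i] at h2
    simp only [integral_const, probReal_univ, one_smul] at h2
    have h3 := mul_le_mul_of_nonneg_left hsum hC
    linarith
  have h2 : Ψ (fun i => ∫ z, g i (block z i) ∂γ) ≤
      Ψ (fun i => ∫ z, F (block z i) i ∂γ) + (ε / 4 + C * (k * (8 * η))) := by
    have hgI : (fun i => ∫ z, g i (block z i) ∂γ) ∈ closedCube k := fun i =>
      integral_mem_Icc (hgmeas i) fun z => hgcube z i
    have hFI : (fun i => ∫ z, F (block z i) i ∂γ) ∈ closedCube k := fun i =>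
      integral_mem_Icc (hFmeas' i) fun z => hFcube _ i
    refine (hmod' _ hgI _ hFI).trans ?_
    have h3 : ∑ i, |∫ z, g i (block z i) ∂γ - ∫ z, F (block z i) i ∂γ| ≤ k * (8 * η) := by
      refine (Finset.sum_le_sum fun i _ => ?_).trans hsum
      rw [abs_sub_comm, ← integral_sub (hFint i) (hgint i)]
      exact abs_integral_le_integral_abs (μ := γ)
    gcongr
  linarith

end

end GaussianDiffusion

/-! ### Extension of `Ψ` and transfer to `X` -/

/-- `X = (X_1, …, X_k)` is a centred Gaussian vector in `ℝ^{kn}` with covariance `M ⊗ I_n`.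
`Ψ` is continuous on the closed cube and twice continuously differentiable in the open cube,
where `M ⊙ H_Ψ` is negative semidefinite. -/
theorem proposition5 {k n : ℕ} (M : Matrix (Fin k) (Fin k) ℝ)
    (hM : M.PosDef) (hdiag : ∀ i, M i i = 1)
    {Ω : Type*} [MeasurableSpace Ω] (P : Measure Ω) [IsProbabilityMeasure P]
    (X : Ω → EuclideanSpace ℝ (Fin k × Fin n))
    (hX : HasLaw X (multivariateGaussian 0 (M ⊗ₖ (1 : Matrix (Fin n) (Fin n) ℝ))) P)
    (Ψ : (Fin k → ℝ) → ℝ)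
    (hΨcont : ContinuousOn Ψ (closedCube k))
    (hΨdiff : ContDiffOn ℝ 2 Ψ (openCube k))
    (hΨ : ∀ x ∈ openCube k, (-(M ⊙ hessianMatrix Ψ x)).PosSemidef)
    (F : EuclideanSpace ℝ (Fin n) → Fin k → ℝ)
    (hFmeas : Measurable F) (hFcube : ∀ y, F y ∈ closedCube k) :
    Integrable (fun ω => Ψ (blockEval F (X ω))) P ∧
      ∫ ω, Ψ (blockEval F (X ω)) ∂P ≤ Ψ (fun i => ∫ ω, F (block (X ω) i) i ∂P) := by
  -- Composing `Ψ` with this retraction onto the cube makes it continuous and bounded everywhere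
  -- without changing it on the cube, hence with the same Hessian in the interior.
  set c : (Fin k → ℝ) → Fin k → ℝ := fun x i => max 0 (min (x i) 1) with hc
  have hcc : Continuous c := by fun_prop
  have hcmem : ∀ x, c x ∈ closedCube k := fun x i =>
    ⟨le_max_left _ _, max_le zero_le_one (min_le_right _ _)⟩
  have hcid : ∀ x ∈ closedCube k, c x = x := fun x hx => by
    ext i
    simp only [hc]
    rw [min_eq_left (hx i).2, max_eq_right (hx i).1]
  set Φ : (Fin k → ℝ) → ℝ := fun x => Ψ (c x) with hΦ
  have hΦΨ : ∀ x ∈ closedCube k, Φ x = Ψ x := fun x hx => by rw [hΦ]; simp only [hcid x hx]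
  have hΦc : Continuous Φ := hΨcont.comp_continuous hcc hcmem
  obtain ⟨B, hB⟩ := (isCompact_closedCube k).exists_bound_of_continuousOn hΨcont
  have hΦB : ∀ x, |Φ x| ≤ B := fun x => hB _ (hcmem x)
  have hΦdiff : ContDiffOn ℝ 2 Φ (openCube k) :=
    hΨdiff.congr fun x hx => hΦΨ x (openCube_subset_closedCube k hx)
  have hH : ∀ x ∈ openCube k, hessianMatrix Φ x = hessianMatrix Ψ x := fun x hx => by
    have h1 : Φ =ᶠ[nhds x] Ψ := by
      filter_upwards [(isOpen_openCube k).mem_nhds hx] with y hy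
      exact hΦΨ y (openCube_subset_closedCube k hy)
    unfold hessianMatrix
    rw [h1.fderiv.fderiv_eq]
  have hmain := integral_blockEval_le hM.posSemidef hΦc hΦB hΦdiff
    (fun x hx => by rw [hH x hx]; exact hΨ x hx) hFmeas hFcube
  have hFX : ∀ z, Φ (blockEval F z) = Ψ (blockEval F z) := fun z =>
    hΦΨ _ fun i => hFcube _ i
  have hmeas : Measurable fun z => Φ (blockEval F z) :=
    hΦc.measurable.comp (measurable_blockEval hFmeas)
  have hmeasi : ∀ i, Measurable fun z : EuclideanSpace ℝ (Fin k × Fin n) => F (block z i) i :=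
    fun i => (measurable_pi_iff.1 hFmeas i).comp (measurable_block i)
  have e1 : ∫ ω, Φ (blockEval F (X ω)) ∂P = _ := hX.integral_comp hmeas.aestronglyMeasurable
  have e2 : ∀ i, ∫ ω, F (block (X ω) i) i ∂P = _ := fun i =>
    hX.integral_comp (hmeasi i).aestronglyMeasurable
  have hcube : (fun i => ∫ z, F (block z i) i
      ∂(multivariateGaussian 0 (M ⊗ₖ (1 : Matrix (Fin n) (Fin n) ℝ)))) ∈ closedCube k :=
    fun i => integral_mem_Icc (hmeasi i) fun z => hFcube _ i
  simp_rw [← hFX]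
  refine ⟨Integrable.of_mem_Icc (-B) B (hmeas.comp_aemeasurable hX.aemeasurable)
    (.of_forall fun ω => abs_le.1 (hΦB _)), ?_⟩
  simp_rw [e2]
  rw [e1, ← hΦΨ _ hcube]
  exact hmain
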